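/- Let $(\mathsf X,\mathcal F,\pi)$ be a probability space, and let $P$ and $Q$ be Markov kernels on $(\mathsf X,\mathcal F)$ that are reversible with respect to $\pi$, i.e. $\int_A P(x,B)\,\pi(dx)=\int_B P(x,A)\,\pi(dx)$ for all $A,B\in\mathcal F$, and likewise for $Q$. Suppose that each of $P$ and $Q$ is $\varphi$-irreducible, where a Markov kernel $K$ is called $\varphi$-irreducible if there is a non-zero $\sigma$-finite measure $\varphi$ on $(\mathsf X,\mathcal F)$ (which may depend on $K$) such that for every $A\in\mathcal F$ with $\varphi(A)>0$ and every $x\in\mathsf X$ there is $n\in\mathbb N$ with $K^n(x,A)>0$. Suppose that $P$ Peskun dominates $Q$, i.e. for $\pi$-almost every $x\in\mathsf X$, $$P(x,A\setminus\{x\})\ \ge\ Q(x,A\setminus\{x\})\qquad\text{for every }A\in\mathcal F .$$ For $K\in\{P,Q\}$ and $f\in L^2(\pi)$ real-valued, let $$v(f,K)=\lim_{N\to\infty}\frac1N\operatorname{Var}\Big(\sum_{k=1}^N f(X_k)\Big),$$ where $(X_k)_{k\ge1}$ is a Markov chain with kernel $K$ and $X_1\sim\pi$. Then $P$ efficiency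 dominates $Q$: for every $f\in L^2(\pi)$ the limits $v(f,P)$ and $v(f,Q)$ exist in $[0,\infty]$, and $$v(f,P)\ \le\ v(f,Q).$$ -/

import Mathlib

open MeasureTheory ProbabilityTheory Filter Topology
open scoped ENNReal

namespace MarkovEfficiency

variable {X : Type*} [MeasurableSpace X]

/-- The transition of a time-homogeneous Markov chain with kernel `P`, seen as a kernel from the
history `(x 0, …, x n)` to the next state: it depends on the history only through `x n`. -/
noncomputable def step (P : Kernel X X) (n : ℕ) : Kernel (Finset.Iic n → X) X :=
  P.comap (fun x => x ⟨n, Finset.mem_Iic.2 le_rfl⟩) (measurable_pi_apply _)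

instance (P : Kernel X X) [IsMarkovKernel P] (n : ℕ) : IsMarkovKernel (step P n) := by
  unfold step; infer_instance

/-- The law, on the space of trajectories `ℕ → X`, of the Markov chain with kernel `P` started in
the distribution `π`. The coordinates `ω 0, ω 1, …` are the successive states of the chain. -/
noncomputable def chainLaw (P : Kernel X X) [IsMarkovKernel P] (π : Measure X) :
    Measure (ℕ → X) :=
  Kernel.trajMeasure (X := fun _ => X) π (step P)

/-- `P` is `φ`-irreducible: there is a non-zero `σ`-finite measure `φ` such that every measurable
set of positive `φ`-measure is reached with positive probability from every point. -/
def PhiIrreducible (P : Kernel X X) : Prop :=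
  ∃ φ : Measure X, SigmaFinite φ ∧ φ ≠ 0 ∧ Kernel.IsIrreducible φ P

/-- The asymptotic variance `v(f, P)` exists in `[0, ∞]` and equals `v`: the variance of the sum of
the values of `f` at the first `N` states of the chain with kernel `P` started in `π`, divided by
`N`, tends to `v`. -/
def HasAsymptoticVariance (P : Kernel X X) [IsMarkovKernel P] (π : Measure X) (f : X → ℝ)
    (v : ℝ≥0∞) : Prop :=
  Tendsto
    (fun N : ℕ =>
      evariance (fun ω : ℕ → X => ∑ k ∈ Finset.range N, f (ω k)) (chainLaw P π) / (N : ℝ≥0∞))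
    atTop (𝓝 v)

/-- `P` efficiency dominates `Q`: for every `f ∈ L²(π)`, both asymptotic variances exist in
`[0, ∞]` and `v(f, P) ≤ v(f, Q)`. -/
def EfficiencyDominates (P Q : Kernel X X) [IsMarkovKernel P] [IsMarkovKernel Q]
    (π : Measure X) : Prop :=
  ∀ f : X → ℝ, MemLp f 2 π →
    ∃ vP vQ : ℝ≥0∞, HasAsymptoticVariance P π f vP ∧ HasAsymptoticVariance Q π f vQ ∧ vP ≤ vQ

/-- `P` Peskun dominates `Q` (dominance off the diagonal). -/
def PeskunDominates (P Q : Kernel X X) (π : Measure X) : Prop :=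
  ∀ᵐ x ∂π, ∀ A : Set X, MeasurableSet A → Q x (A \ {x}) ≤ P x (A \ {x})

end MarkovEfficiency

/-! For centred `f` let `a k = ⟪f, T ^ k f⟫`, with `T` the operator of the kernel on `L²(π)`.
Reversibility makes `T` a symmetric contraction, and the asymptotic variance is `2 W - ‖f‖²`, where
`W`, formally `⟪f, (1 - T)⁻¹ f⟫`, is the limit of the partial sums of `a`, last term halved.
Formally `W = sup_g (2 ⟪f, g⟫ - ⟪g, (1 - T) g⟫)`, so a larger Dirichlet form gives a smaller
variance. Peskun dominance orders the forms because `(g x - g y) ^ 2` vanishes on the diagonal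
(`PeskunDominates.dirichlet_le`).

Since `1 - T` need not be invertible, the finite vectors `trapVec` replace the resolvent, without
spectral theory. Halving the last term makes the sums monotone along even indices
(`trapSum_two_mul_succ`), so `W` exists, possibly infinite. When `W` is finite, `trapVec` solves the
Poisson equation up to a vanishing error, which yields the comparison `trapSum_two_mul_le`. The link
with the chain is `evariance_sum_chainLaw`. -/

namespace MarkovEfficiency

/-! ### Cesàro limits of autocovariance sums. -/

/-- The Cesàro means of a real sequence tending to `∞` tend to `∞`. -/
lemma tendsto_cesaro_atTop {u : ℕ → ℝ} (hu : Tendsto u atTop atTop) :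
    Tendsto (fun n : ℕ => (n : ℝ)⁻¹ * ∑ i ∈ Finset.range n, u i) atTop atTop := by
  refine tendsto_atTop.2 fun M => ?_
  have h1 : Tendsto (fun n => min (u n) (M + 1)) atTop (𝓝 (M + 1)) := by
    refine tendsto_const_nhds.congr' ?_
    filter_upwards [hu.eventually_ge_atTop (M + 1)] with n hn
    rw [min_eq_right hn]
  filter_upwards [h1.cesaro.eventually (lt_mem_nhds (lt_add_one M))] with n hn
  refine hn.le.trans ?_
  gcongr
  exact min_le_left _ _

/-- Partial sums of a sequence, with half weight on the last term. -/
noncomputable def trapSum (a : ℕ → ℝ) (n : ℕ) : ℝ := ∑ k ∈ Finset.range n, a k + a n / 2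

lemma trapSum_succ (a : ℕ → ℝ) (n : ℕ) :
    trapSum a (n + 1) = trapSum a n + (a n + a (n + 1)) / 2 := by
  simp only [trapSum, Finset.sum_range_succ]; ring

/-- The variance of the sum of `N` consecutive terms of a stationary sequence with
autocovariances `a`. -/
noncomputable def sumVar (a : ℕ → ℝ) (N : ℕ) : ℝ :=
  ∑ n ∈ Finset.range N, (2 * ∑ k ∈ Finset.range (n + 1), a k - a 0)

/-- Here `2 * ∑ k ≤ n, a k = 2 * trapSum a n + a n`, and the leftover terms `a n` sum to `trapSum a
N - a N / 2`. Thus `sumVar a N / N` is governed by a Cesàro mean of `trapSum a`. -/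
lemma sumVar_eq (a : ℕ → ℝ) (N : ℕ) :
    sumVar a N = 2 * ∑ n ∈ Finset.range N, trapSum a n + (trapSum a N - a N / 2) - N * a 0 := by
  induction N with
  | zero => simp [sumVar, trapSum]
  | succ N ih =>
    rw [sumVar, Finset.sum_range_succ, ← sumVar, ih, Finset.sum_range_succ, trapSum_succ]
    simp only [trapSum, Finset.sum_range_succ]
    push_cast
    ring

lemma tendsto_bounded_div {a : ℕ → ℝ} {C : ℝ} (ha : ∀ n, |a n| ≤ C) :
    Tendsto (fun n : ℕ => (n : ℝ)⁻¹ * a n) atTop (𝓝 0) := by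
  refine (tendsto_natCast_atTop_atTop (R := ℝ)).inv_tendsto_atTop.zero_mul_isBoundedUnder_le ?_
  exact isBoundedUnder_of ⟨C, fun n => by simpa using ha n⟩

lemma tendsto_sumVar_div {a : ℕ → ℝ} {C W : ℝ} (ha : ∀ n, |a n| ≤ C)
    (h : Tendsto (trapSum a) atTop (𝓝 W)) :
    Tendsto (fun N : ℕ => sumVar a N / N) atTop (𝓝 (2 * W - a 0)) := by
  have h2 : Tendsto (fun n : ℕ => (n : ℝ)⁻¹ * trapSum a n) atTop (𝓝 0) := by
    simpa using (tendsto_natCast_atTop_atTop (R := ℝ)).inv_tendsto_atTop.mul h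
  have h3 := tendsto_bounded_div ha
  have := ((h.cesaro.const_mul 2).add (h2.sub (h3.div_const 2))).sub_const (a 0)
  simp only [zero_div, sub_zero, add_zero] at this
  refine this.congr' ?_
  filter_upwards [eventually_ne_atTop 0] with N hN
  have : (N : ℝ) ≠ 0 := by exact_mod_cast hN
  rw [sumVar_eq]
  field_simp

lemma tendsto_sumVar_div_atTop {a : ℕ → ℝ} {C : ℝ} (ha : ∀ n, |a n| ≤ C)
    (h : Tendsto (trapSum a) atTop atTop) :
    Tendsto (fun N : ℕ => sumVar a N / N) atTop atTop := by
  have h1 := tendsto_atTop_add_const_right _ (-a 0)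
    ((tendsto_cesaro_atTop h).const_mul_atTop (zero_lt_two (α := ℝ)))
  refine tendsto_atTop_mono' _ ?_ h1
  filter_upwards [eventually_ne_atTop 0, h.eventually_ge_atTop C] with N hN hC
  have hN' : (N : ℝ) ≠ 0 := by exact_mod_cast hN
  -- This remainder is only dropped by sign, so no bound on the growth of `trapSum a` is needed.
  have h2 : 0 ≤ trapSum a N - a N / 2 := by
    have := ha N
    have := abs_nonneg (a N)
    have := le_abs_self (a N)
    linarith
  have h3 : sumVar a N / N = 2 * ((N : ℝ)⁻¹ * ∑ n ∈ Finset.range N, trapSum a n) + -a 0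
      + (trapSum a N - a N / 2) / N := by
    rw [sumVar_eq]; field_simp; ring
  rw [h3]
  have : 0 ≤ (trapSum a N - a N / 2) / (N : ℝ) := by positivity
  linarith

/-! ### Symmetric contractions and their Dirichlet forms. -/

section Hilbert

variable {H : Type*} [NormedAddCommGroup H] [InnerProductSpace ℝ H]

/-- A symmetric contraction of a real inner product space. -/
structure IsSymmContraction (T : H →L[ℝ] H) : Prop where
  symm : ∀ x y, inner ℝ (T x) y = inner ℝ x (T y)
  norm_le : ∀ x, ‖T x‖ ≤ ‖x‖

/-- The autocovariances `⟪f, T ^ n f⟫`. -/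
noncomputable def autocov (T : H →L[ℝ] H) (f : H) (n : ℕ) : ℝ := inner ℝ f ((T ^ n) f)

/-- The quadratic form `⟪g, (1 - T) g⟫`. -/
noncomputable def dirichlet (T : H →L[ℝ] H) (g : H) : ℝ := inner ℝ g (g - T g)

/-- Partial sums of the Neumann series of `1 - T` at `f`, with half weight on the last term. -/
noncomputable def trapVec (T : H →L[ℝ] H) (f : H) (n : ℕ) : H :=
  ∑ k ∈ Finset.range n, (T ^ k) f + (1 / 2 : ℝ) • (T ^ n) f

lemma inner_trapVec (T : H →L[ℝ] H) (f : H) (n : ℕ) :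
    inner ℝ f (trapVec T f n) = trapSum (autocov T f) n := by
  simp only [trapVec, trapSum, autocov, inner_add_right, inner_sum, inner_smul_right]; ring

lemma trapVec_succ (T : H →L[ℝ] H) (f : H) (n : ℕ) :
    trapVec T f (n + 1) = trapVec T f n + (1 / 2 : ℝ) • ((T ^ n) f + T ((T ^ n) f)) := by
  simp only [trapVec, Finset.sum_range_succ, pow_succ' T n, mul_apply_eq_comp]
  module

/-- `trapVec T f n` solves the Poisson equation up to an explicit error. -/
lemma trapVec_sub (T : H →L[ℝ] H) (f : H) (n : ℕ) :
    trapVec T f n - T (trapVec T f n) + (1 / 2 : ℝ) • ((T ^ n) f + T ((T ^ n) f)) = f := by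
  induction n with
  | zero => simp [trapVec]; module
  | succ n ih =>
    rw [trapVec_succ]
    refine Eq.trans ?_ ih
    simp only [pow_succ' T n, mul_apply_eq_comp, map_add, map_smul]
    module

namespace IsSymmContraction

variable {T : H →L[ℝ] H}

lemma norm_pow_le (hT : IsSymmContraction T) (f : H) (n : ℕ) : ‖(T ^ n) f‖ ≤ ‖f‖ := by
  induction n with
  | zero => simp
  | succ n ih =>
    rw [pow_succ', mul_apply_eq_comp]
    exact (hT.norm_le _).trans ih

lemma inner_pow (hT : IsSymmContraction T) (f : H) (i j : ℕ) :
    inner ℝ ((T ^ i) f) ((T ^ j) f) = autocov T f (i + j) := by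
  induction i generalizing j with
  | zero => simp [autocov]
  | succ i ih =>
    rw [pow_succ', mul_apply_eq_comp, hT.symm, ← mul_apply_eq_comp,
      ← pow_succ', ih]
    congr 1; ring

lemma abs_autocov_le (hT : IsSymmContraction T) (f : H) (n : ℕ) :
    |autocov T f n| ≤ ‖f‖ * ‖f‖ :=
  (abs_real_inner_le_norm _ _).trans
    (mul_le_mul_of_nonneg_left (hT.norm_pow_le f n) (norm_nonneg _))

lemma dirichlet_nonneg (hT : IsSymmContraction T) (g : H) : 0 ≤ dirichlet T g := by
  rw [dirichlet, inner_sub_right, sub_nonneg]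
  refine (real_inner_le_norm _ _).trans ?_
  rw [real_inner_self_eq_norm_mul_norm]
  exact mul_le_mul_of_nonneg_left (hT.norm_le g) (norm_nonneg _)

lemma inner_self_add (hT : IsSymmContraction T) (f : H) (n : ℕ) :
    inner ℝ ((T ^ n) f) ((T ^ n) f + T ((T ^ n) f)) =
      autocov T f (2 * n) + autocov T f (2 * n + 1) := by
  rw [← mul_apply_eq_comp, ← pow_succ', inner_add_right, hT.inner_pow, hT.inner_pow]
  congr 2 <;> ring

lemma autocov_pair_nonneg (hT : IsSymmContraction T) (f : H) (n : ℕ) :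
    0 ≤ autocov T f (2 * n) + autocov T f (2 * n + 1) := by
  rw [← hT.inner_self_add, inner_add_right, real_inner_self_eq_norm_mul_norm]
  have h := neg_le_of_abs_le (abs_real_inner_le_norm ((T ^ n) f) (T ((T ^ n) f)))
  have := mul_le_mul_of_nonneg_left (hT.norm_le ((T ^ n) f)) (norm_nonneg ((T ^ n) f))
  linarith

/-- With half weights the increment is `(a (2n) + 2 a (2n+1) + a (2n+2)) / 2`, which symmetry of `T`
turns into a perfect square. -/
lemma trapSum_two_mul_succ (hT : IsSymmContraction T) (f : H) (n : ℕ) :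
    trapSum (autocov T f) (2 * (n + 1)) =
      trapSum (autocov T f) (2 * n) + ‖(T ^ n) f + T ((T ^ n) f)‖ ^ 2 / 2 := by
  rw [mul_add, mul_one, show 2 * n + 2 = 2 * n + 1 + 1 from rfl, trapSum_succ, trapSum_succ,
    ← real_inner_self_eq_norm_sq, ← mul_apply_eq_comp, ← pow_succ', inner_add_right,
    inner_add_left, inner_add_left, hT.inner_pow, hT.inner_pow, hT.inner_pow, hT.inner_pow,
    show n + n = 2 * n by ring, show n + 1 + n = 2 * n + 1 by ring,
    show n + (n + 1) = 2 * n + 1 by ring, show n + 1 + (n + 1) = 2 * n + 1 + 1 by ring]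
  ring

lemma monotone_trapSum_two_mul (hT : IsSymmContraction T) (f : H) :
    Monotone fun n => trapSum (autocov T f) (2 * n) :=
  monotone_nat_of_le_succ fun n => by
    rw [hT.trapSum_two_mul_succ]
    have := sq_nonneg ‖(T ^ n) f + T ((T ^ n) f)‖
    linarith

lemma inner_trapVec_pow (hT : IsSymmContraction T) (f : H) (n : ℕ) :
    ∀ m, inner ℝ (trapVec T f n) ((T ^ m) f) =
      trapSum (autocov T f) (m + n) - trapSum (autocov T f) m
        + autocov T f m / 2 := by
  intro m
  induction n with
  | zero => simp [trapVec, autocov, inner_smul_left]; ring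
  | succ n ih =>
    rw [trapVec_succ, inner_add_left, ih, inner_smul_left, ← mul_apply_eq_comp,
      ← pow_succ', inner_add_left, hT.inner_pow, hT.inner_pow, ← add_assoc, trapSum_succ,
      show n + m = m + n by ring, show n + 1 + m = m + n + 1 by ring]
    simp; ring

/-- The value at `trapVec T f n` of the variational functional `2 ⟪f, g⟫ - ⟪g, (1 - T) g⟫`. -/
lemma two_inner_sub_dirichlet (hT : IsSymmContraction T) (f : H) (n : ℕ) :
    2 * trapSum (autocov T f) n - dirichlet T (trapVec T f n) =
      trapSum (autocov T f) (2 * n) +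
        (autocov T f (2 * n) + autocov T f (2 * n + 1)) / 4 := by
  have h1 : trapVec T f n - T (trapVec T f n)
      = f - (1 / 2 : ℝ) • ((T ^ n) f + (T ^ (n + 1)) f) := by
    rw [pow_succ', mul_apply_eq_comp, eq_sub_iff_add_eq]
    exact trapVec_sub T f n
  rw [dirichlet, h1, inner_sub_right, real_inner_comm, inner_trapVec, inner_smul_right,
    inner_add_right, hT.inner_trapVec_pow, hT.inner_trapVec_pow,
    show n + 1 + n = 2 * n + 1 by ring, show n + n = 2 * n by ring, trapSum_succ, trapSum_succ]
  ring

/-- Nonnegativity of the form at `g - h`, expanded by symmetry. -/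
lemma dirichlet_add_dirichlet (hT : IsSymmContraction T) (g h : H) :
    2 * inner ℝ (g - T g) h ≤ dirichlet T g + dirichlet T h := by
  have h1 := hT.dirichlet_nonneg (g - h)
  have h2 : dirichlet T (g - h) = dirichlet T g + dirichlet T h - 2 * inner ℝ (g - T g) h := by
    have := hT.symm g h
    have h3 := real_inner_comm (T h) g
    have h4 := real_inner_comm (T g) h
    have h5 := real_inner_comm h g
    simp only [dirichlet, map_sub, inner_sub_left, inner_sub_right] at *
    linarith
  linarith

/-- If the trapezoidal sums of autocovariances converge along even indices, they converge. -/
lemma tendsto_trapSum (hT : IsSymmContraction T) {f : H} {W : ℝ}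
    (h : Tendsto (fun n => trapSum (autocov T f) (2 * n)) atTop (𝓝 W)) :
    Tendsto (fun n => ‖(T ^ n) f + T ((T ^ n) f)‖) atTop (𝓝 0) ∧
    Tendsto (fun n => autocov T f (2 * n) + autocov T f (2 * n + 1)) atTop (𝓝 0) ∧
    Tendsto (trapSum (autocov T f)) atTop (𝓝 W) := by
  have h1 : Tendsto (fun n => ‖(T ^ n) f + T ((T ^ n) f)‖) atTop (𝓝 0) := by
    -- The increments of a convergent sequence vanish, and twice the increment is the squared norm.
    have h2 := (((tendsto_add_atTop_iff_nat 1).2 h).sub h).const_mul 2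
    have h3 := h2.sqrt
    simp only [sub_self, mul_zero, Real.sqrt_zero] at h3
    refine h3.congr fun n => ?_
    rw [hT.trapSum_two_mul_succ, show ∀ x y : ℝ, 2 * (x + y / 2 - x) = y by intros; ring,
      Real.sqrt_sq (norm_nonneg _)]
  have h2 : Tendsto (fun n => autocov T f (2 * n) + autocov T f (2 * n + 1)) atTop (𝓝 0) := by
    have h3 := h1.const_mul ‖f‖
    rw [mul_zero] at h3
    refine squeeze_zero (hT.autocov_pair_nonneg f) (fun n => ?_) h3
    rw [← hT.inner_self_add]
    refine (real_inner_le_norm _ _).trans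
      (mul_le_mul_of_nonneg_right (hT.norm_pow_le f n) (norm_nonneg _))
  refine ⟨h1, h2, ?_⟩
  have h3 : Tendsto (fun n => trapSum (autocov T f) (2 * n + 1)) atTop (𝓝 W) := by
    have := h.add (h2.div_const 2)
    simp only [zero_div, add_zero] at this
    exact this.congr fun n => (trapSum_succ _ _).symm
  rw [Metric.tendsto_atTop] at h h3 ⊢
  intro ε hε
  obtain ⟨N, hN⟩ := h ε hε
  obtain ⟨M, hM⟩ := h3 ε hε
  refine ⟨2 * N + 2 * M, fun n hn => ?_⟩
  obtain ⟨k, rfl | rfl⟩ := Nat.even_or_odd' n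
  · exact hN k (by omega)
  · exact hM k (by omega)

lemma tendsto_trapSum_atTop (hT : IsSymmContraction T) {f : H}
    (h : Tendsto (fun n => trapSum (autocov T f) (2 * n)) atTop atTop) :
    Tendsto (trapSum (autocov T f)) atTop atTop := by
  rw [tendsto_atTop_atTop] at h ⊢
  intro b
  obtain ⟨N, hN⟩ := h b
  refine ⟨2 * N, fun n hn => ?_⟩
  obtain ⟨k, rfl | rfl⟩ := Nat.even_or_odd' n
  · exact hN k (by omega)
  · have := hT.autocov_pair_nonneg f k
    have := hN k (by omega)
    rw [trapSum_succ]
    linarith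

lemma tendsto_trapSum_or (hT : IsSymmContraction T) (f : H) :
    Tendsto (trapSum (autocov T f)) atTop atTop ∨
      ∃ W, Tendsto (trapSum (autocov T f)) atTop (𝓝 W) :=
  (tendsto_atTop_of_monotone (hT.monotone_trapSum_two_mul f)).imp hT.tendsto_trapSum_atTop
    fun ⟨W, hW⟩ => ⟨W, (hT.tendsto_trapSum hW).2.2⟩

/-- Comparison of the sums of autocovariances of two ordered symmetric contractions. -/
lemma trapSum_two_mul_le {S : H →L[ℝ] H} (hT : IsSymmContraction T) (hS : IsSymmContraction S)
    (hST : ∀ g, dirichlet S g ≤ dirichlet T g) {f : H} {W : ℝ}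
    (h : Tendsto (trapSum (autocov S f)) atTop (𝓝 W)) (n : ℕ) :
    trapSum (autocov T f) (2 * n) ≤ W := by
  have he : Tendsto (fun n => trapSum (autocov S f) (2 * n)) atTop (𝓝 W) :=
    h.comp (tendsto_id.const_mul_atTop' two_pos)
  obtain ⟨h1, h2, -⟩ := hS.tendsto_trapSum he
  set g := trapVec T f n with hg
  -- By `two_inner_sub_dirichlet` these terms are `dirichlet S (trapVec S f m)` plus the Poisson
  -- error paired with `g`; they tend to `2 W - W`.
  have hlim : Tendsto (fun m => 2 * trapSum (autocov S f) m - (trapSum (autocov S f) (2 * m) +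
      (autocov S f (2 * m) + autocov S f (2 * m + 1)) / 4)
      + ‖(S ^ m) f + S ((S ^ m) f)‖ * ‖g‖) atTop (𝓝 W) := by
    have := ((h.const_mul 2).sub (he.add (h2.div_const 4))).add (h1.mul_const ‖g‖)
    convert this using 2
    ring
  refine ge_of_tendsto' hlim fun m => ?_
  have e1 := hT.two_inner_sub_dirichlet f n
  have e2 := hS.two_inner_sub_dirichlet f m
  have e3 := hT.autocov_pair_nonneg f n
  have e4 := hS.dirichlet_add_dirichlet (trapVec S f m) g
  have e5 := hST g
  -- `f` is replaced by `(1 - S) (trapVec S f m)` plus its error; `e4` and `e5` then bound `2 ⟪f, g⟫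
  -- - dirichlet T g`, which is at least the left side by `e1` and `e3`.
  have e6 : 2 * inner ℝ f g = 2 * inner ℝ (trapVec S f m - S (trapVec S f m)) g
      + inner ℝ ((S ^ m) f + S ((S ^ m) f)) g := by
    nth_rw 1 [← trapVec_sub S f m]
    rw [inner_add_left, inner_smul_left]
    simp; ring
  have e7 := real_inner_le_norm ((S ^ m) f + S ((S ^ m) f)) g
  rw [hg, inner_trapVec, ← hg] at e6
  linarith

end IsSymmContraction
/-- Of two symmetric contractions ordered by their quadratic forms, the larger form has the smaller
asymptotic variance. -/
lemma exists_tendsto_sumVar_le {H : Type*} [NormedAddCommGroup H] [InnerProductSpace ℝ H]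
    {T S : H →L[ℝ] H} (hT : IsSymmContraction T) (hS : IsSymmContraction S)
    (hTS : ∀ g, dirichlet S g ≤ dirichlet T g) (g : H) :
    ∃ v w : ℝ≥0∞,
      Tendsto (fun N : ℕ => ENNReal.ofReal (sumVar (autocov T g) N / N)) atTop (𝓝 v) ∧
      Tendsto (fun N : ℕ => ENNReal.ofReal (sumVar (autocov S g) N / N)) atTop (𝓝 w) ∧ v ≤ w := by
  have htop : ∀ {R : H →L[ℝ] H}, IsSymmContraction R →
      Tendsto (trapSum (autocov R g)) atTop atTop →
      Tendsto (fun N : ℕ => ENNReal.ofReal (sumVar (autocov R g) N / N)) atTop (𝓝 ⊤) :=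
    fun hR h => ENNReal.tendsto_ofReal_atTop.comp
      (tendsto_sumVar_div_atTop (hR.abs_autocov_le g) h)
  have hfin : ∀ {T : H →L[ℝ] H} {W : ℝ}, IsSymmContraction T →
      Tendsto (trapSum (autocov T g)) atTop (𝓝 W) →
      Tendsto (fun N : ℕ => ENNReal.ofReal (sumVar (autocov T g) N / N)) atTop
        (𝓝 (ENNReal.ofReal (2 * W - autocov T g 0))) :=
    fun hR h => ENNReal.tendsto_ofReal (tendsto_sumVar_div (hR.abs_autocov_le g) h)
  rcases hS.tendsto_trapSum_or g with hs | ⟨W, hs⟩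
  · rcases hT.tendsto_trapSum_or g with ht | ⟨V, ht⟩
    · exact ⟨_, _, htop hT ht, htop hS hs, le_rfl⟩
    · exact ⟨_, _, hfin hT ht, htop hS hs, le_top⟩
  · have hle := hT.trapSum_two_mul_le hS (hTS) hs
    have h2 : Tendsto (fun n : ℕ => 2 * n) atTop atTop := tendsto_id.const_mul_atTop' two_pos
    rcases hT.tendsto_trapSum_or g with ht | ⟨V, ht⟩
    · obtain ⟨n, hn⟩ := ((ht.comp h2).eventually_gt_atTop W).exists
      exact absurd (hle n) (not_le.2 hn)
    · refine ⟨_, _, hfin hT ht, hfin hS hs, ENNReal.ofReal_le_ofReal ?_⟩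
      have h3 := le_of_tendsto' (ht.comp h2) hle
      -- Both are `‖g‖²`, so only the limits `V ≤ W` matter.
      have h4 : autocov T g 0 = autocov S g 0 := rfl
      linarith

end Hilbert

variable {X : Type*} [MeasurableSpace X]

/-! ### The Markov operator on `L²(π)` via the law of one transition. -/

section Joint

variable {π : Measure X} [IsProbabilityMeasure π] {P : Kernel X X} [IsMarkovKernel P]

lemma measurePreserving_fst_compProd (P : Kernel X X) [IsMarkovKernel P] (π : Measure X)
    [IsProbabilityMeasure π] : MeasurePreserving Prod.fst (π ⊗ₘ P) π :=
  ⟨measurable_fst, Measure.fst_compProd π P⟩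

lemma measurePreserving_snd_compProd (hP : P.Invariant π) :
    MeasurePreserving Prod.snd (π ⊗ₘ P) π :=
  ⟨measurable_snd, (Measure.snd_compProd π P).trans hP⟩

lemma measurePreserving_swap_compProd (hP : P.IsReversible π) :
    MeasurePreserving Prod.swap (π ⊗ₘ P) (π ⊗ₘ P) := by
  refine ⟨measurable_swap, ?_⟩
  refine Measure.ext_prod fun {s t} hs ht => ?_
  rw [Measure.map_apply measurable_swap (hs.prod ht), Set.preimage_swap_prod,
    Measure.compProd_apply_prod ht hs, Measure.compProd_apply_prod hs ht, hP ht hs]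

/-- The operator `g ↦ ∫ y, g y ∂P ·` on `L²(π)`, for a kernel `P` leaving `π` invariant. -/
noncomputable def markovOp (hP : P.Invariant π) : Lp ℝ 2 π →L[ℝ] Lp ℝ 2 π :=
  (Lp.compMeasurePreservingₗᵢ ℝ (E := ℝ) (p := 2) Prod.fst
    (measurePreserving_fst_compProd P π)).toContinuousLinearMap.adjoint ∘L
  (Lp.compMeasurePreservingₗᵢ ℝ (E := ℝ) (p := 2) Prod.snd
    (measurePreserving_snd_compProd hP)).toContinuousLinearMap

lemma inner_markovOp (hP : P.Invariant π) (f g : Lp ℝ 2 π) :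
    inner ℝ f (markovOp hP g) = ∫ z, f z.1 * g z.2 ∂(π ⊗ₘ P) := by
  rw [markovOp, ContinuousLinearMap.comp_apply, ContinuousLinearMap.adjoint_inner_right,
    L2.inner_def]
  refine integral_congr_ae ?_
  filter_upwards [Lp.coeFn_compMeasurePreserving f (measurePreserving_fst_compProd P π),
    Lp.coeFn_compMeasurePreserving g (measurePreserving_snd_compProd hP)] with z h1 h2
  simp only [Function.comp_apply] at h1 h2
  change inner ℝ (Lp.compMeasurePreserving Prod.fst (measurePreserving_fst_compProd P π) f z)
    (Lp.compMeasurePreserving Prod.snd (measurePreserving_snd_compProd hP) g z) = _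
  rw [h1, h2]
  simp [mul_comm]

lemma isSymmContraction_markovOp (hP : P.IsReversible π) :
    IsSymmContraction (markovOp hP.invariant) where
  symm f g := by
    rw [real_inner_comm, inner_markovOp, inner_markovOp,
      ← (measurePreserving_swap_compProd hP).integral_comp
        MeasurableEquiv.prodComm.measurableEmbedding]
    simp [mul_comm]
  norm_le f := by
    rw [markovOp, ContinuousLinearMap.comp_apply]
    refine (ContinuousLinearMap.le_opNorm _ _).trans ?_
    rw [LinearIsometryEquiv.norm_map]
    refine (mul_le_mul_of_nonneg_right (LinearIsometry.norm_toContinuousLinearMap_le _)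
      (norm_nonneg _)).trans ?_
    simp

lemma memLp_fst (P : Kernel X X) [IsMarkovKernel P] (f : Lp ℝ 2 π) :
    MemLp (fun z : X × X => f z.1) 2 (π ⊗ₘ P) :=
  (Lp.memLp f).comp_measurePreserving (measurePreserving_fst_compProd P π)

lemma memLp_snd (hP : P.Invariant π) (f : Lp ℝ 2 π) :
    MemLp (fun z : X × X => f z.2) 2 (π ⊗ₘ P) :=
  (Lp.memLp f).comp_measurePreserving (measurePreserving_snd_compProd hP)

/-- Expanding the square works because both marginals of `π ⊗ₘ P` are `π`. -/
lemma two_mul_dirichlet_markovOp (hP : P.Invariant π) (g : Lp ℝ 2 π) :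
    2 * dirichlet (markovOp hP) g = ∫ z, (g z.1 - g z.2) ^ 2 ∂(π ⊗ₘ P) := by
  have h1 := memLp_fst P g
  have h2 := memLp_snd hP g
  have e1 : inner ℝ g g = ∫ z, g z.1 ^ 2 ∂(π ⊗ₘ P) := by
    have : Measurable fun x => g x ^ 2 := (Lp.stronglyMeasurable g).measurable.pow_const 2
    rw [L2.inner_def, ← integral_map (φ := Prod.fst) (f := fun x => g x ^ 2) (by fun_prop)
      (by fun_prop), (measurePreserving_fst_compProd P π).map_eq]
    simp [sq]
  have e2 : inner ℝ g g = ∫ z, g z.2 ^ 2 ∂(π ⊗ₘ P) := by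
    have : Measurable fun x => g x ^ 2 := (Lp.stronglyMeasurable g).measurable.pow_const 2
    rw [L2.inner_def, ← integral_map (φ := Prod.snd) (f := fun x => g x ^ 2) (by fun_prop)
      (by fun_prop), (measurePreserving_snd_compProd hP).map_eq]
    simp [sq]
  have e3 := inner_markovOp hP g g
  have e4 : ∀ z : X × X, (g z.1 - g z.2) ^ 2 = g z.1 ^ 2 + g z.2 ^ 2 - 2 * (g z.1 * g z.2) :=
    fun z => by ring
  simp_rw [e4]
  rw [integral_sub, integral_add, integral_const_mul, ← e1, ← e2, ← e3, dirichlet,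
    inner_sub_right]
  · ring
  · exact h1.integrable_sq
  · exact h2.integrable_sq
  · exact h1.integrable_sq.add h2.integrable_sq
  · exact (h1.integrable_mul h2).const_mul 2

lemma ofReal_two_mul_dirichlet (hP : P.Invariant π) (g : Lp ℝ 2 π) :
    ENNReal.ofReal (2 * dirichlet (markovOp hP) g) =
      ∫⁻ x, ∫⁻ y, ENNReal.ofReal ((g x - g y) ^ 2) ∂P x ∂π := by
  have hg : Measurable g := (Lp.stronglyMeasurable g).measurable
  rw [two_mul_dirichlet_markovOp, ofReal_integral_eq_lintegral_ofReal,
    Measure.lintegral_compProd (by fun_prop)]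
  · exact ((memLp_fst P g).sub (memLp_snd hP g)).integrable_sq
  · exact ae_of_all _ fun z => sq_nonneg _

/-- Tested against indicators; this connects the adjoint construction with conditional expectations
along the chain. -/
lemma markovOp_ae_eq (hP : P.Invariant π) (g : Lp ℝ 2 π) :
    markovOp hP g =ᵐ[π] fun x => ∫ y, g y ∂P x := by
  have h2 : Integrable (fun z : X × X => g z.2) (π ⊗ₘ P) :=
    (memLp_snd hP g).integrable one_le_two
  refine Integrable.ae_eq_of_forall_setIntegral_eq _ _
    ((Lp.memLp (markovOp hP g)).integrable one_le_two) ?_ fun s hs _ => ?_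
  · exact Integrable.integral_compProd (κ := Kernel.const Unit π)
      (η := Kernel.prodMkLeft Unit P) (a := ()) h2
  · have h3 := inner_markovOp hP (indicatorConstLp 2 hs (measure_ne_top π s) (1 : ℝ)) g
    have h4 := Measure.setIntegral_compProd (μ := π) (κ := P) hs MeasurableSet.univ
      h2.integrableOn
    simp only [Measure.restrict_univ] at h4
    rw [L2.inner_indicatorConstLp_one] at h3
    rw [h3, ← h4, ← integral_indicator (hs.prod MeasurableSet.univ)]
    refine integral_congr_ae ?_
    filter_upwards [(measurePreserving_fst_compProd P π).quasiMeasurePreserving.ae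
      (indicatorConstLp_coeFn (p := 2) (hs := hs) (hμs := measure_ne_top π s)
        (c := (1 : ℝ)))] with z hz
    rw [hz]
    by_cases h : z.1 ∈ s <;> simp [Set.indicator, h]

end Joint

/-! ### From Peskun dominance to ordered Dirichlet forms. -/

lemma lintegral_le_of_peskun {μ ν : Measure X} {x : X}
    (h : ∀ A : Set X, MeasurableSet A → ν (A \ {x}) ≤ μ (A \ {x})) {φ : X → ℝ≥0∞}
    (hφ : Measurable φ) (hx : φ x = 0) : ∫⁻ y, φ y ∂ν ≤ ∫⁻ y, φ y ∂μ := by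
  have hS : MeasurableSet (Function.support φ) := measurableSet_support hφ
  have hφS : φ = (Function.support φ).indicator φ := Set.indicator_support.symm
  rw [hφS, lintegral_indicator hS, lintegral_indicator hS]
  -- The support of `φ` misses `x`, so the measures restricted to it are ordered; `{x}` itself need
  -- not be measurable.
  refine lintegral_mono' (Measure.le_iff.2 fun A hA => ?_) le_rfl
  rw [Measure.restrict_apply hA, Measure.restrict_apply hA]
  have hxS : x ∉ A ∩ Function.support φ := fun h => h.2 hx
  simpa [Set.sdiff_singleton_eq_self hxS] using h _ (hA.inter hS)

lemma PeskunDominates.dirichlet_le {π : Measure X} [IsProbabilityMeasure π] {P Q : Kernel X X}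
    [IsMarkovKernel P] [IsMarkovKernel Q] (h : PeskunDominates P Q π) (hP : P.IsReversible π)
    (hQ : Q.IsReversible π) (g : Lp ℝ 2 π) :
    dirichlet (markovOp hQ.invariant) g ≤ dirichlet (markovOp hP.invariant) g := by
  have hg : Measurable g := (Lp.stronglyMeasurable g).measurable
  have h0 := (isSymmContraction_markovOp hP).dirichlet_nonneg g
  have key : ENNReal.ofReal (2 * dirichlet (markovOp hQ.invariant) g) ≤
      ENNReal.ofReal (2 * dirichlet (markovOp hP.invariant) g) := by
    rw [ofReal_two_mul_dirichlet, ofReal_two_mul_dirichlet]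
    refine lintegral_mono_ae ?_
    filter_upwards [h] with x hx
    exact lintegral_le_of_peskun hx (by fun_prop) (by simp)
  rw [ENNReal.ofReal_le_ofReal_iff (by positivity)] at key
  linarith

/-! ### Covariances and variances along the stationary chain. -/

section Chain

variable {π : Measure X} [IsProbabilityMeasure π] {P : Kernel X X} [IsMarkovKernel P]

instance (P : Kernel X X) [IsMarkovKernel P] (π : Measure X) [IsProbabilityMeasure π] :
    IsProbabilityMeasure (chainLaw P π) := by
  unfold chainLaw; infer_instance

/-- The Markov property of the chain: the law of the history together with the next state. -/
lemma map_frestrictLe_succ_chainLaw (P : Kernel X X) [IsMarkovKernel P] (π : Measure X)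
    [IsProbabilityMeasure π] (n : ℕ) :
    (chainLaw P π).map (fun ω => (Preorder.frestrictLe n ω, ω (n + 1))) =
      (chainLaw P π).map (Preorder.frestrictLe n) ⊗ₘ step P n :=
  (Kernel.map_frestrictLe_trajMeasure_compProd_eq_map_trajMeasure (X := fun _ => X)).symm

lemma map_zero_chainLaw (P : Kernel X X) [IsMarkovKernel P] (π : Measure X)
    [IsProbabilityMeasure π] : (chainLaw P π).map (fun ω => ω 0) = π := by
  have h1 : (fun ω : ℕ → X => ω 0) =
      (fun y : Finset.Iic 0 → X => y ⟨0, by simp⟩) ∘ Preorder.frestrictLe (π := fun _ => X) 0 := by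
    ext; simp
  rw [h1, ← Measure.map_map (by fun_prop) (by fun_prop), chainLaw, Kernel.trajMeasure,
    Measure.map_comp _ _ (by fun_prop), Kernel.traj_map_frestrictLe, Kernel.partialTraj_self,
    Measure.id_comp, Measure.map_map (by fun_prop) (by fun_prop)]
  exact Measure.map_id

lemma measurePreserving_eval_chainLaw (hP : P.Invariant π) (n : ℕ) :
    MeasurePreserving (fun ω : ℕ → X => ω n) (chainLaw P π) π := by
  refine ⟨by fun_prop, ?_⟩
  induction n with
  | zero => exact map_zero_chainLaw P π
  | succ n ih =>
    have h1 : (fun ω : ℕ → X => ω (n + 1)) =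
        Prod.snd ∘ fun ω => (Preorder.frestrictLe (π := fun _ => X) n ω, ω (n + 1)) := rfl
    rw [h1, ← Measure.map_map (by fun_prop) (by fun_prop), map_frestrictLe_succ_chainLaw]
    refine (Measure.snd_compProd _ _).trans ?_
    ext A hA
    have hm : Measurable fun x => P x A := P.measurable_coe hA
    rw [Measure.bind_apply hA (Kernel.aemeasurable _)]
    have h2 : ∀ y, step P n y A = P (y ⟨n, Finset.mem_Iic.2 le_rfl⟩) A := fun y => rfl
    simp_rw [h2]
    rw [lintegral_map (by fun_prop) (by fun_prop)]
    conv_rhs => rw [← hP.def, Measure.bind_apply hA (Kernel.aemeasurable _), ← ih]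
    rw [lintegral_map hm (by fun_prop)]
    rfl

lemma memLp_eval_chainLaw (hP : P.Invariant π) {f : X → ℝ} (hf : MemLp f 2 π) (n : ℕ) :
    MemLp (fun ω : ℕ → X => f (ω n)) 2 (chainLaw P π) :=
  hf.comp_measurePreserving (measurePreserving_eval_chainLaw hP n)

lemma integral_eval_chainLaw (hP : P.Invariant π) {f : X → ℝ} (hf : AEStronglyMeasurable f π)
    (n : ℕ) : ∫ ω, f (ω n) ∂chainLaw P π = ∫ x, f x ∂π := by
  have h := measurePreserving_eval_chainLaw hP n
  conv_rhs => rw [← h.map_eq]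
  rw [integral_map h.measurable.aemeasurable (by rwa [h.map_eq])]

/-- Condition on the history up to time `n`: since `i ≤ n`, the factor `f (ω i)` comes out of the
inner integral. -/
lemma integral_mul_eval_succ (hP : P.Invariant π) (f g : Lp ℝ 2 π) {i n : ℕ} (hin : i ≤ n) :
    ∫ ω, f (ω i) * g (ω (n + 1)) ∂chainLaw P π =
      ∫ ω, f (ω i) * markovOp hP g (ω n) ∂chainLaw P π := by
  have hf : Measurable f := (Lp.stronglyMeasurable f).measurable
  have hg : Measurable g := (Lp.stronglyMeasurable g).measurable
  have hTg : (fun ω : ℕ → X => markovOp hP g (ω n)) =ᵐ[chainLaw P π]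
      fun ω => ∫ y, g y ∂P (ω n) :=
    (measurePreserving_eval_chainLaw hP n).quasiMeasurePreserving.ae_eq (markovOp_ae_eq hP g)
  have hi : i ∈ Finset.Iic n := Finset.mem_Iic.2 hin
  have hmeas : Measurable fun z : (Finset.Iic n → X) × X => f (z.1 ⟨i, hi⟩) * g z.2 := by fun_prop
  have hpair : Measurable fun ω : ℕ → X =>
      (Preorder.frestrictLe (π := fun _ => X) n ω, ω (n + 1)) := by
    fun_prop
  have hint : Integrable (fun z : (Finset.Iic n → X) × X => f (z.1 ⟨i, hi⟩) * g z.2)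
      ((chainLaw P π).map (fun ω => (Preorder.frestrictLe n ω, ω (n + 1)))) := by
    rw [integrable_map_measure hmeas.aestronglyMeasurable hpair.aemeasurable]
    exact (memLp_eval_chainLaw hP (Lp.memLp f) i).integrable_mul
      (memLp_eval_chainLaw hP (Lp.memLp g) (n + 1))
  have hinner : StronglyMeasurable fun x => ∫ y, g y ∂P x :=
    (Lp.stronglyMeasurable g).integral_kernel
  calc ∫ ω, f (ω i) * g (ω (n + 1)) ∂chainLaw P π
      = ∫ z, f (z.1 ⟨i, hi⟩) * g z.2
          ∂(chainLaw P π).map (fun ω => (Preorder.frestrictLe n ω, ω (n + 1))) := by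
        rw [integral_map hpair.aemeasurable hmeas.aestronglyMeasurable]; rfl
    _ = ∫ y, f (y ⟨i, hi⟩) * ∫ x, g x ∂P (y ⟨n, Finset.mem_Iic.2 le_rfl⟩)
          ∂(chainLaw P π).map (Preorder.frestrictLe n) := by
        rw [map_frestrictLe_succ_chainLaw] at hint ⊢
        rw [Measure.integral_compProd hint]
        simp_rw [integral_const_mul]
        rfl
    _ = ∫ ω, f (ω i) * ∫ y, g y ∂P (ω n) ∂chainLaw P π := by
        rw [integral_map (by fun_prop)]
        · rfl
        · exact ((hf.comp (measurable_pi_apply _)).mul (hinner.measurable.comp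
            (measurable_pi_apply _))).aestronglyMeasurable
    _ = _ := by
        refine integral_congr_ae ?_
        filter_upwards [hTg] with ω hω
        rw [hω]

lemma integral_mul_eval_add (hP : P.Invariant π) (f g : Lp ℝ 2 π) (i k : ℕ) :
    ∫ ω, f (ω i) * g (ω (i + k)) ∂chainLaw P π = inner ℝ f ((markovOp hP ^ k) g) := by
  induction k generalizing g with
  | zero =>
    rw [L2.inner_def]
    refine (integral_eval_chainLaw hP (f := fun x => f x * g x) ?_ i).trans ?_
    · exact (Lp.aestronglyMeasurable f).mul (Lp.aestronglyMeasurable g)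
    · simp [mul_comm]
  | succ k ih =>
    rw [← add_assoc, integral_mul_eval_succ hP f g (Nat.le_add_right i k), ih, pow_succ]
    rfl

lemma integral_sum_eval_sq (hP : P.Invariant π) (f : Lp ℝ 2 π) (N : ℕ) :
    ∫ ω, (∑ k ∈ Finset.range N, f (ω k)) ^ 2 ∂chainLaw P π =
      sumVar (autocov (markovOp hP) f) N := by
  have hmem := fun n => memLp_eval_chainLaw hP (Lp.memLp f) n
  induction N with
  | zero => simp [sumVar]
  | succ N ih =>
    have hS : MemLp (fun ω : ℕ → X => ∑ k ∈ Finset.range N, f (ω k)) 2 (chainLaw P π) :=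
      memLp_finsetSum _ fun k _ => hmem k
    have h1 : ∀ ω : ℕ → X, (∑ k ∈ Finset.range (N + 1), f (ω k)) ^ 2 =
        (∑ k ∈ Finset.range N, f (ω k)) ^ 2
          + 2 * ∑ k ∈ Finset.range N, f (ω k) * f (ω N) + f (ω N) * f (ω N) := fun ω => by
      rw [Finset.sum_range_succ, ← Finset.sum_mul]; ring
    have hi : ∀ i j, Integrable (fun ω : ℕ → X => f (ω i) * f (ω j)) (chainLaw P π) :=
      fun i j => (hmem i).integrable_mul (hmem j)
    have h2 : ∑ k ∈ Finset.range N, ∫ ω, f (ω k) * f (ω N) ∂chainLaw P π =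
        ∑ k ∈ Finset.range N, autocov (markovOp hP) f (k + 1) := by
      -- Reversing the order indexes the pairs by lag: times `N - 1 - k` and `N` differ by `k + 1`.
      rw [← Finset.sum_range_reflect]
      refine Finset.sum_congr rfl fun k hk => ?_
      have hk := Finset.mem_range.1 hk
      have := integral_mul_eval_add hP f f (N - 1 - k) (k + 1)
      rwa [show N - 1 - k + (k + 1) = N by omega] at this
    have h3 := integral_mul_eval_add hP f f N 0
    rw [add_zero] at h3
    simp_rw [h1]
    have h4 : Integrable (fun ω : ℕ → X => 2 * ∑ k ∈ Finset.range N, f (ω k) * f (ω N))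
        (chainLaw P π) := (integrable_finsetSum _ fun k _ => hi k N).const_mul 2
    rw [integral_add ?_ (hi N N), integral_add hS.integrable_sq h4, ih, integral_const_mul,
      integral_finsetSum _ fun k _ => hi k N, h2, h3, sumVar, sumVar, Finset.sum_range_succ _ N,
      Finset.sum_range_succ' _ N]
    · change _ + autocov (markovOp hP) f 0 = _
      ring
    · exact hS.integrable_sq.add h4

/-- The variance of a stationary sum in terms of the autocovariances of the centred function. -/
lemma evariance_sum_chainLaw (hP : P.Invariant π) {f : X → ℝ} (hf : MemLp f 2 π) (N : ℕ) :
    evariance (fun ω : ℕ → X => ∑ k ∈ Finset.range N, f (ω k)) (chainLaw P π) =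
      ENNReal.ofReal (sumVar (autocov (markovOp hP)
        ((hf.sub (memLp_const (∫ x, f x ∂π))).toLp _)) N) := by
  set m := ∫ x, f x ∂π with hm
  set g := (hf.sub (memLp_const m)).toLp _ with hg
  have hmem := fun n => memLp_eval_chainLaw hP (Lp.memLp g) n
  have hS : MemLp (fun ω : ℕ → X => ∑ k ∈ Finset.range N, g (ω k)) 2 (chainLaw P π) :=
    memLp_finsetSum _ fun k _ => hmem k
  have hgm : ∫ x, g x ∂π = 0 := by
    rw [integral_congr_ae (MemLp.coeFn_toLp _)]
    simp only [Pi.sub_apply]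
    rw [integral_sub (hf.integrable one_le_two) (integrable_const _)]
    simp [hm]
  have hae : (fun ω : ℕ → X => ∑ k ∈ Finset.range N, f (ω k)) =ᵐ[chainLaw P π]
      fun ω => ∑ k ∈ Finset.range N, g (ω k) + N * m := by
    have : ∀ᵐ ω ∂chainLaw P π, ∀ k, g (ω k) = f (ω k) - m := ae_all_iff.2 fun k =>
      (measurePreserving_eval_chainLaw hP k).quasiMeasurePreserving.ae (MemLp.coeFn_toLp _)
    filter_upwards [this] with ω hω
    simp [hω]
  have hmean : ∫ ω, ∑ k ∈ Finset.range N, g (ω k) ∂chainLaw P π = 0 := by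
    rw [integral_finsetSum _ fun k _ => (hmem k).integrable one_le_two]
    refine Finset.sum_eq_zero fun k _ => ?_
    rw [integral_eval_chainLaw hP (Lp.aestronglyMeasurable g), hgm]
  have hS' : MemLp (fun ω : ℕ → X => ∑ k ∈ Finset.range N, g (ω k) + N * m) 2 (chainLaw P π) :=
    hS.add (memLp_const _)
  rw [evariance_congr hae, ← ofReal_variance hS',
    variance_add_const hS.aestronglyMeasurable,
    variance_of_integral_eq_zero hS.aestronglyMeasurable.aemeasurable hmean,
    integral_sum_eval_sq hP g N]

lemma hasAsymptoticVariance_iff (hP : P.Invariant π) {f : X → ℝ} (hf : MemLp f 2 π) (v : ℝ≥0∞) :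
    HasAsymptoticVariance P π f v ↔
      Tendsto (fun N : ℕ => ENNReal.ofReal (sumVar (autocov (markovOp hP)
        ((hf.sub (memLp_const (∫ x, f x ∂π))).toLp _)) N / N)) atTop (𝓝 v) := by
  refine tendsto_congr' ?_
  filter_upwards [eventually_gt_atTop 0] with N hN
  rw [evariance_sum_chainLaw hP hf, ENNReal.ofReal_div_of_pos (by exact_mod_cast hN),
    ENNReal.ofReal_natCast]

end Chain

end MarkovEfficiency

theorem theorem6p2 {X : Type*} [MeasurableSpace X] (π : Measure X) [IsProbabilityMeasure π]
    (P Q : Kernel X X) [IsMarkovKernel P] [IsMarkovKernel Q]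
    (hPrev : P.IsReversible π) (hQrev : Q.IsReversible π)
    (hPirr : MarkovEfficiency.PhiIrreducible P) (hQirr : MarkovEfficiency.PhiIrreducible Q)
    (hPQ : MarkovEfficiency.PeskunDominates P Q π) :
    MarkovEfficiency.EfficiencyDominates P Q π := by
  intro f hf
  obtain ⟨v, w, hv, hw, hvw⟩ := MarkovEfficiency.exists_tendsto_sumVar_le
    (MarkovEfficiency.isSymmContraction_markovOp hPrev)
    (MarkovEfficiency.isSymmContraction_markovOp hQrev) (hPQ.dirichlet_le hPrev hQrev)
    ((hf.sub (memLp_const (∫ x, f x ∂π))).toLp _)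
  exact ⟨v, w, (MarkovEfficiency.hasAsymptoticVariance_iff hPrev.invariant hf v).2 hv,
    (MarkovEfficiency.hasAsymptoticVariance_iff hQrev.invariant hf w).2 hw, hvw⟩
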